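/- Let $N\ge 1$ be an integer, $p>1$ and $q>\frac{2p}{p+1}$. There is a constant $c=c_{N,p,q}>0$, depending only on $N$, $p$ and $q$, such that for every $M>0$ the following holds. 1. Let $\Omega\subset\mathbb{R}^N$ be a domain (a nonempty connected open set) and let $u\in C^2(\Omega)$, $u\ge 0$, satisfy $-\Delta u=u^p+M|\nabla u|^q$ in $\Omega$. Then $$|\nabla u(x)|\le c\left(M^{-\frac{p+1}{(p+1)q-2p}}+\bigl(M\,\mathrm{dist}(x,\partial\Omega)\bigr)^{-\frac1{q-1}}\right)\qquad\text{for all }x\in\Omega,$$ where the last term is read as $0$ if $\Omega=\mathbb{R}^N$. 2. Consequently, every ground state, that is, every positive $u\in C^2(\mathbb{R}^N)$ with $-\Delta u=u^p+M|\nabla u|^q$ in $\mathbb{R}^N$, satisfies $$|\nabla u(x)|\le c\,M^{-\frac{p+1}{(p+1)q-2p}}\qquad\text{for all }x\in\mathbb{R}^N,$$ and therefore grows at most linearly: $u(x)\le u(0)+c\,M^{-\frac{p+1}{(p+1)q-2p}}\,|x|$ for all $x\in\mathbb{R}^N$. -/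

import Mathlib

open scoped Gradient

/-- A nonnegative classical solution, of class `C²` in `Ω`, of
`-Δ u = u ^ p + M * |∇ u| ^ q` in `Ω ⊆ ℝ^N`. -/
structure IsSolution {N : ℕ} (p q M : ℝ) (Ω : Set (EuclideanSpace ℝ (Fin N)))
    (u : EuclideanSpace ℝ (Fin N) → ℝ) : Prop where
  contDiffOn : ContDiffOn ℝ 2 u Ω
  nonneg : ∀ x ∈ Ω, 0 ≤ u x
  equation : ∀ x ∈ Ω, -(Laplacian.laplacian u x) = u x ^ p + M * ‖∇ u x‖ ^ q

/-- A ground state: a positive solution in the whole space `ℝ^N`. -/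
structure IsGroundState {N : ℕ} (p q M : ℝ) (u : EuclideanSpace ℝ (Fin N) → ℝ) : Prop where
  isSolution : IsSolution p q M Set.univ u
  pos : ∀ x, 0 < u x

/-! Bernstein's method. Put z = |∇u|² and f = u^p + M|∇u|^q = -Δu. For smooth u, Bochner's formula
and |D²u|² ≥ (Δu)²/N give Δz/2 ≥ f²/N - ⟨∇f, ∇u⟩, where ⟨∇f, ∇u⟩ = p u^(p-1) z + M (q/2) z^(q/2-1)
⟨∇z, ∇u⟩. By Young's inequality (`mul_rpow_mul_sq_le`), u^(p-1) z costs a u^(2p), absorbed by f²,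
plus a multiple of |∇u|^(4p/(p+1)). For large gradients the latter is of lower order than
M²|∇u|^(2q), precisely because q > 2p/(p+1).

To localize, (R² - |x-a|²)^β |∇u| is maximized over a closed ball. At a maximum point with nonzero
gradient, the barrier w = m (R² - |y-a|²)^(-2β) touches z from above, so ∇z = ∇w and the Bochner
expression is at most Δw/2 (`bernstein_inequality_of_isLocalMax`). What remains is an inequality
between numbers (`exists_le_of_bernstein_inequality`), and the choice β = 1/(q-1) carries its
conclusion back to the centre (`exists_norm_gradient_le_of_closedBall`). A radius of half the
distance to the boundary gives the first estimate, R → ∞ the global one.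

Since u is only C², z is only C¹. `bochner_le_laplacian_of_strict_max` therefore runs the maximum
principle on sums of squared difference quotients and passes to the limit. -/

open Filter Topology

/-! ### Second-order calculus: Hessians, Laplacians and local maxima. -/

section Calculus

variable {E : Type*} [NormedAddCommGroup E]

section Normed

variable [NormedSpace ℝ E]

theorem ContDiffAt.eventually_differentiableAt {g : E → ℝ} {x : E} (hg : ContDiffAt ℝ 2 g x) :
    ∀ᶠ y in 𝓝 x, DifferentiableAt ℝ g y :=
  (hg.eventually (by simp)).mono fun _ hy => hy.differentiableAt (by simp)

theorem ContDiffAt.contDiffAt_fderiv_of_two {g : E → ℝ} {x : E} (hg : ContDiffAt ℝ 2 g x) :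
    ContDiffAt ℝ 1 (fderiv ℝ g) x :=
  hg.fderiv_right (m := 1) (by norm_num)

theorem ContDiffAt.differentiableAt_fderiv {g : E → ℝ} {x : E} (hg : ContDiffAt ℝ 2 g x) :
    DifferentiableAt ℝ (fderiv ℝ g) x :=
  hg.contDiffAt_fderiv_of_two.differentiableAt (by simp)

/-- The Hessian at a local maximum is nonpositive. -/
theorem IsLocalMax.fderiv_fderiv_apply_nonpos {g : E → ℝ} {x : E} (hmax : IsLocalMax g x)
    (hg : ContDiffAt ℝ 2 g x) (e : E) : fderiv ℝ (fderiv ℝ g) x e e ≤ 0 := by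
  have hline : ∀ t : ℝ, HasDerivAt (fun t : ℝ => x + t • e) e t := fun t => by
    simpa using ((hasDerivAt_id t).smul_const e).const_add x
  have hcont : Tendsto (fun t : ℝ => x + t • e) (𝓝 0) (𝓝 x) := by
    simpa using (hline 0).continuousAt.tendsto
  have h1 : deriv (fun t : ℝ => g (x + t • e)) =ᶠ[𝓝 0] fun t => fderiv ℝ g (x + t • e) e := by
    filter_upwards [hcont.eventually hg.eventually_differentiableAt] with t ht
    exact (ht.hasFDerivAt.comp_hasDerivAt t (hline t)).deriv
  have h2 : deriv (deriv fun t : ℝ => g (x + t • e)) 0 = fderiv ℝ (fderiv ℝ g) x e e := by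
    rw [h1.deriv_eq]
    have hd : HasFDerivAt (fderiv ℝ g) (fderiv ℝ (fderiv ℝ g) x) (x + (0 : ℝ) • e) := by
      simpa using hg.differentiableAt_fderiv.hasFDerivAt
    have hd' : HasDerivAt (fun t : ℝ => fderiv ℝ g (x + t • e)) (fderiv ℝ (fderiv ℝ g) x e) 0 :=
      hd.comp_hasDerivAt 0 (hline 0)
    have hd'' : HasDerivAt (fun t : ℝ => fderiv ℝ g (x + t • e) e)
        (fderiv ℝ (fderiv ℝ g) x e e) 0 :=
      ((ContinuousLinearMap.apply ℝ ℝ e).hasFDerivAt).comp_hasDerivAt 0 hd'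
    exact hd''.deriv
  have hmax0 : IsLocalMax (fun t : ℝ => g (x + t • e)) 0 := by
    have := hcont.eventually hmax
    simpa [IsLocalMax, IsMaxFilter] using this
  by_contra! hpos
  rw [← h2] at hpos
  have hc : ContinuousAt (fun t : ℝ => g (x + t • e)) 0 := by
    have : ContinuousAt g (x + (0 : ℝ) • e) := by simpa using hg.continuousAt
    exact ContinuousAt.comp (f := fun t : ℝ => x + t • e) this (hline 0).continuousAt
  -- A positive second derivative would make 0 a local minimum as well, so the function would be
  -- locally constant and its second derivative zero.
  have hmin := isLocalMin_of_deriv_deriv_pos hpos hmax0.deriv_eq_zero hc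
  have hconst : (fun t : ℝ => g (x + t • e)) =ᶠ[𝓝 0] fun _ => g (x + (0 : ℝ) • e) := by
    filter_upwards [hmin, hmax0] with t h1 h2 using le_antisymm h2 h1
  have := hconst.deriv.deriv_eq
  simp at this
  rw [this] at hpos
  exact lt_irrefl _ hpos

/-- The Hessian of a composition `F ∘ v`. -/
theorem fderiv_fderiv_comp_apply {v : E → ℝ} {x : E} (hv : ContDiffAt ℝ 2 v x) {F F' : ℝ → ℝ}
    {F'' : ℝ} (hF : ∀ᶠ s in 𝓝 (v x), HasDerivAt F (F' s) s) (hF' : HasDerivAt F' F'' (v x))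
    (e e' : E) :
    fderiv ℝ (fderiv ℝ fun y => F (v y)) x e e' =
      F'' * (fderiv ℝ v x e * fderiv ℝ v x e') + F' (v x) * fderiv ℝ (fderiv ℝ v) x e e' := by
  have h1 : (fderiv ℝ fun y => F (v y)) =ᶠ[𝓝 x] fun y => F' (v y) • fderiv ℝ v y := by
    filter_upwards [hv.continuousAt.eventually hF, hv.eventually_differentiableAt] with y h h'
    exact (h.comp_hasFDerivAt y h'.hasFDerivAt).fderiv
  rw [h1.fderiv_eq]
  have hd := (hv.differentiableAt (by simp)).hasFDerivAt
  have := (hF'.comp_hasFDerivAt x hd).smul hv.differentiableAt_fderiv.hasFDerivAt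
  have h2 : fderiv ℝ (fun y => F' (v y) • fderiv ℝ v y) x = _ := this.fderiv
  rw [h2]
  simp
  ring

/-- Difference quotients with moving base point converge to the derivative at a point of strict
differentiability. -/
theorem HasStrictFDerivAt.tendsto_difference_quotient {f : E → ℝ} {f' : E →L[ℝ] ℝ} {y : E}
    (hf : HasStrictFDerivAt f f' y) {ι : Type*} {l : Filter ι} {x : ι → E} {h : ι → ℝ}
    (hx : Tendsto x l (𝓝 y)) (hh : Tendsto h l (𝓝 0)) (hne : ∀ᶠ n in l, h n ≠ 0) (e : E) :
    Tendsto (fun n => (h n)⁻¹ * (f (x n + h n • e) - f (x n))) l (𝓝 (f' e)) := by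
  have hx' : Tendsto (fun n => x n + h n • e) l (𝓝 y) := by
    simpa using hx.add (hh.smul_const e)
  have ho := hf.isLittleO.comp_tendsto (hx'.prodMk_nhds hx)
  have ho2 : (fun n => f (x n + h n • e) - f (x n) - h n * f' e) =o[l] h := by
    have hO : (fun n => h n • e) =O[l] h :=
      Asymptotics.IsBigO.of_bound ‖e‖ (Eventually.of_forall fun n => by
        rw [norm_smul, mul_comm])
    refine Asymptotics.IsLittleO.trans_isBigO ?_ hO
    simpa [Function.comp_def] using ho
  have ht := ho2.tendsto_div_nhds_zero.add_const (f' e)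
  rw [zero_add] at ht
  refine ht.congr' ?_
  filter_upwards [hne] with n hn
  field_simp
  ring

end Normed

variable [InnerProductSpace ℝ E]

theorem fderiv_norm_sub_sq (a x : E) :
    fderiv ℝ (fun y => ‖y - a‖ ^ 2) x = 2 • innerSL ℝ (x - a) := by
  have := ((hasFDerivAt_id x).sub_const a).norm_sq
  simpa using this.fderiv

theorem contDiff_norm_sub_sq (a : E) : ContDiff ℝ 2 fun y : E => ‖y - a‖ ^ 2 :=
  (contDiff_id.sub contDiff_const).norm_sq ℝ

variable [FiniteDimensional ℝ E] {ι : Type*} [Fintype ι]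

theorem laplacian_eq_sum_fderiv_fderiv (b : OrthonormalBasis ι ℝ E) (g : E → ℝ) (x : E) :
    Laplacian.laplacian g x = ∑ i, fderiv ℝ (fderiv ℝ g) x (b i) (b i) := by
  rw [InnerProductSpace.laplacian_eq_iteratedFDeriv_orthonormalBasis g b]
  simp [iteratedFDeriv_two_apply]

theorem sum_sq_fderiv_eq_norm_gradient_sq (b : OrthonormalBasis ι ℝ E) (g : E → ℝ) (x : E) :
    ∑ i, fderiv ℝ g x (b i) ^ 2 = ‖∇ g x‖ ^ 2 := by
  rw [← b.sum_sq_norm_inner_left]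
  refine Finset.sum_congr rfl fun i _ => ?_
  rw [← toDual_gradient, InnerProductSpace.toDual_apply_apply, Real.norm_eq_abs, sq_abs]

theorem laplacian_comp {v : E → ℝ} {x : E} (hv : ContDiffAt ℝ 2 v x) {F F' : ℝ → ℝ}
    {F'' : ℝ} (hF : ∀ᶠ s in 𝓝 (v x), HasDerivAt F (F' s) s) (hF' : HasDerivAt F' F'' (v x)) :
    Laplacian.laplacian (fun y => F (v y)) x =
      F'' * ‖∇ v x‖ ^ 2 + F' (v x) * Laplacian.laplacian v x := by
  let b := stdOrthonormalBasis ℝ E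
  rw [laplacian_eq_sum_fderiv_fderiv b, laplacian_eq_sum_fderiv_fderiv b,
    ← sum_sq_fderiv_eq_norm_gradient_sq b, Finset.mul_sum, Finset.mul_sum,
    ← Finset.sum_add_distrib]
  exact Finset.sum_congr rfl fun i _ => by
    rw [fderiv_fderiv_comp_apply hv hF hF', sq]

theorem laplacian_sq {v : E → ℝ} {x : E} (hv : ContDiffAt ℝ 2 v x) :
    Laplacian.laplacian (fun y => v y ^ 2) x =
      2 * ‖∇ v x‖ ^ 2 + 2 * v x * Laplacian.laplacian v x := by
  refine laplacian_comp (F := fun s => s ^ 2) (F' := fun s => 2 * s) hv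
    (Eventually.of_forall fun s => ?_) ?_
  · simpa using hasDerivAt_pow 2 s
  · simpa using (hasDerivAt_id (v x)).const_mul 2

theorem laplacian_finset_sum {κ : Type*} (s : Finset κ) {g : κ → E → ℝ} {x : E}
    (hg : ∀ i ∈ s, ContDiffAt ℝ 2 (g i) x) :
    Laplacian.laplacian (fun y => ∑ i ∈ s, g i y) x = ∑ i ∈ s, Laplacian.laplacian (g i) x := by
  classical
  induction s using Finset.induction_on with
  | empty => simp
  | insert a s ha ih =>
    simp only [Finset.sum_insert ha]
    rw [← ih fun i hi => hg i (Finset.mem_insert_of_mem hi)]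
    exact ContDiffAt.laplacian_add (hg a (Finset.mem_insert_self a s))
      (ContDiffAt.sum fun i hi => hg i (Finset.mem_insert_of_mem hi))

theorem IsLocalMax.laplacian_nonpos {g : E → ℝ} {x : E} (hmax : IsLocalMax g x)
    (hg : ContDiffAt ℝ 2 g x) : Laplacian.laplacian g x ≤ 0 := by
  rw [laplacian_eq_sum_fderiv_fderiv (stdOrthonormalBasis ℝ E)]
  exact Finset.sum_nonpos fun i _ => hmax.fderiv_fderiv_apply_nonpos hg _

theorem ContDiffAt.continuousAt_laplacian {g : E → ℝ} {x : E} (hg : ContDiffAt ℝ 2 g x) :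
    ContinuousAt (Laplacian.laplacian g) x := by
  have : Laplacian.laplacian g = fun y =>
      ∑ i, fderiv ℝ (fderiv ℝ g) y (stdOrthonormalBasis ℝ E i) (stdOrthonormalBasis ℝ E i) :=
    funext fun y => laplacian_eq_sum_fderiv_fderiv _ g y
  rw [this]
  have hc : ContinuousAt (fderiv ℝ (fderiv ℝ g)) x :=
    (hg.contDiffAt_fderiv_of_two.fderiv_right (m := 0) (by norm_num)).continuousAt
  fun_prop

theorem norm_gradient_norm_sub_sq (a x : E) :
    ‖∇ (fun y => ‖y - a‖ ^ 2) x‖ = 2 * ‖x - a‖ := by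
  rw [← (InnerProductSpace.toDual ℝ E).norm_map, toDual_gradient, fderiv_norm_sub_sq]
  rw [← Nat.cast_smul_eq_nsmul ℝ, norm_smul, innerSL_apply_norm]
  simp

theorem laplacian_norm_sub_sq (a x : E) :
    Laplacian.laplacian (fun y => ‖y - a‖ ^ 2) x = 2 * Module.finrank ℝ E := by
  have h : fderiv ℝ (fun y : E => ‖y - a‖ ^ 2) = fun x => 2 • innerSL ℝ (x - a) :=
    funext fun x => fderiv_norm_sub_sq a x
  have h2 : fderiv ℝ (fun x : E => 2 • innerSL ℝ (x - a)) x = 2 • innerSL ℝ := by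
    have := (((innerSL ℝ (E := E)).hasFDerivAt (x := x - a)).comp x
      ((hasFDerivAt_id x).sub_const a)).const_smul 2
    exact this.fderiv
  rw [laplacian_eq_sum_fderiv_fderiv (stdOrthonormalBasis ℝ E), h, h2]
  have h3 : ∀ i, (2 • innerSL ℝ (E := E)) (stdOrthonormalBasis ℝ E i) (stdOrthonormalBasis ℝ E i)
      = (2 : ℝ) := fun i => by
    change 2 • inner ℝ (stdOrthonormalBasis ℝ E i) (stdOrthonormalBasis ℝ E i) = (2 : ℝ)
    simp
  rw [Finset.sum_congr rfl fun i _ => h3 i]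
  simp [mul_comm]

end Calculus

/-! ### Bochner's inequality at a maximum, for C² functions. -/

section Bochner

variable {E : Type*} [NormedAddCommGroup E] [InnerProductSpace ℝ E]

/-- The difference quotient of `u` in the direction `e` with step `h`. -/
noncomputable def differenceQuotient (u : E → ℝ) (e : E) (h : ℝ) (x : E) : ℝ :=
  h⁻¹ * (u (x + h • e) - u x)

theorem ContDiffAt.differenceQuotient {u : E → ℝ} {e x : E} {h : ℝ} (hx : ContDiffAt ℝ 2 u x)
    (hx' : ContDiffAt ℝ 2 u (x + h • e)) : ContDiffAt ℝ 2 (differenceQuotient u e h) x := by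
  have : ContDiffAt ℝ 2 (fun y => u (y + h • e)) x :=
    ContDiffAt.comp x hx' (contDiffAt_id.add contDiffAt_const)
  exact contDiffAt_const.mul (this.sub hx)

theorem fderiv_differenceQuotient {u : E → ℝ} {e x : E} {h : ℝ} (hx : ContDiffAt ℝ 2 u x)
    (hx' : ContDiffAt ℝ 2 u (x + h • e)) (e' : E) :
    fderiv ℝ (differenceQuotient u e h) x e' =
      h⁻¹ * (fderiv ℝ u (x + h • e) e' - fderiv ℝ u x e') := by
  have h1 : HasFDerivAt (fun y => u (y + h • e)) (fderiv ℝ u (x + h • e)) x := by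
    have := (hx'.differentiableAt (by simp)).hasFDerivAt
    exact (hasFDerivAt_comp_add_right _).2 this
  have h2 := ((h1.sub (hx.differentiableAt (by simp)).hasFDerivAt).const_mul h⁻¹).fderiv
  have h3 : fderiv ℝ (differenceQuotient u e h) x = _ := h2
  simp [h3]

variable [FiniteDimensional ℝ E]

theorem laplacian_differenceQuotient {u : E → ℝ} {e x : E} {h : ℝ} (hx : ContDiffAt ℝ 2 u x)
    (hx' : ContDiffAt ℝ 2 u (x + h • e)) :
    Laplacian.laplacian (differenceQuotient u e h) x =
      h⁻¹ * (Laplacian.laplacian u (x + h • e) - Laplacian.laplacian u x) := by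
  have h0 : ContDiffAt ℝ 2 (fun y => u (y + h • e)) x :=
    ContDiffAt.comp x hx' (contDiffAt_id.add contDiffAt_const)
  have h1 : Laplacian.laplacian (fun y => u (y + h • e)) x
      = Laplacian.laplacian u (x + h • e) := by
    rw [laplacian_eq_sum_fderiv_fderiv (stdOrthonormalBasis ℝ E),
      laplacian_eq_sum_fderiv_fderiv (stdOrthonormalBasis ℝ E)]
    have : (fderiv ℝ fun y => u (y + h • e)) = fun y => fderiv ℝ u (y + h • e) :=
      funext fun y => fderiv_comp_add_right _
    rw [this, fderiv_comp_add_right]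
  have h2 := InnerProductSpace.laplacian_smul (h⁻¹) (h0.sub hx)
  rw [← h1]
  have h3 := h0.laplacian_sub hx
  simp only [smul_eq_mul] at h2
  rw [← h3]
  exact h2

variable {ι : Type*} [Fintype ι]

/-- Maximum principle for the square of the gradient of a `C²` solution of `Δ u = - f`. The Bochner
formula is applied to difference quotients, since `‖∇ u‖ ^ 2` need not be of class `C²`. -/
theorem bochner_le_laplacian_of_strict_max (b : OrthonormalBasis ι ℝ E) {u f w : E → ℝ} {x₀ : E}
    {f' : E →L[ℝ] ℝ} (hu : ContDiffAt ℝ 2 u x₀)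
    (hΔ : ∀ᶠ x in 𝓝 x₀, Laplacian.laplacian u x = -f x) (hf : HasStrictFDerivAt f f' x₀)
    (hw : ContDiffAt ℝ 2 w x₀)
    (hmax : ∀ᶠ x in 𝓝 x₀, x ≠ x₀ → ‖∇ u x‖ ^ 2 - w x < ‖∇ u x₀‖ ^ 2 - w x₀) :
    2 * ∑ i, ∑ j, fderiv ℝ (fderiv ℝ u) x₀ (b i) (b j) ^ 2 - 2 * f' (∇ u x₀)
      ≤ Laplacian.laplacian w x₀ := by
  obtain ⟨ε, hε, hball⟩ := Metric.eventually_nhds_iff_ball.1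
    ((hu.eventually (by simp)).and (hΔ.and ((hw.eventually (by simp)).and hmax)))
  set r := ε / 2 with hr
  have hr0 : 0 < r := by positivity
  have hsub : ∀ x ∈ Metric.closedBall x₀ r, x ∈ Metric.ball x₀ ε := fun x hx =>
    Metric.closedBall_subset_ball (by linarith) hx
  -- The steps lie strictly between 0 and r = ε/2, so shifting a point of the closed r-ball stays in
  -- the ε-ball.
  let h : ℕ → ℝ := fun n => r / (n + 2)
  have hpos : ∀ n, 0 < h n := fun n => by positivity
  have hlt : ∀ n, h n < r := fun n => by
    have : (0 : ℝ) ≤ n := n.cast_nonneg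
    rw [div_lt_iff₀ (by positivity)]; nlinarith
  have hh : Tendsto h atTop (𝓝 0) :=
    tendsto_const_nhds.div_atTop (tendsto_atTop_add_const_right _ _ tendsto_natCast_atTop_atTop)
  have hshift : ∀ n i, ∀ x ∈ Metric.closedBall x₀ r, x + h n • b i ∈ Metric.ball x₀ ε := by
    intro n i x hx
    rw [Metric.mem_closedBall, dist_eq_norm] at hx
    rw [Metric.mem_ball, dist_eq_norm]
    have : ‖h n • b i‖ = h n := by
      rw [norm_smul, b.norm_eq_one, mul_one, Real.norm_of_nonneg (hpos n).le]
    calc ‖x + h n • b i - x₀‖ = ‖(x - x₀) + h n • b i‖ := by congr 1; abel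
      _ ≤ ‖x - x₀‖ + ‖h n • b i‖ := norm_add_le _ _
      _ < ε := by rw [this]; linarith [hlt n]
  have hu1 : ∀ x ∈ Metric.closedBall x₀ r, ContDiffAt ℝ 2 u x := fun x hx =>
    (hball x (hsub x hx)).1
  have hu2 : ∀ n i, ∀ x ∈ Metric.closedBall x₀ r, ContDiffAt ℝ 2 u (x + h n • b i) :=
    fun n i x hx => (hball _ (hshift n i x hx)).1
  have hw1 : ∀ x ∈ Metric.closedBall x₀ r, ContDiffAt ℝ 2 w x := fun x hx =>
    (hball x (hsub x hx)).2.2.1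
  let v : ℕ → ι → E → ℝ := fun n i => differenceQuotient u (b i) (h n)
  let g : ℕ → E → ℝ := fun n x => ∑ i, v n i x ^ 2 - w x
  have hv : ∀ n i, ∀ x ∈ Metric.closedBall x₀ r, ContDiffAt ℝ 2 (v n i) x := fun n i x hx =>
    (hu1 x hx).differenceQuotient (hu2 n i x hx)
  have hg : ∀ n, ∀ x ∈ Metric.closedBall x₀ r, ContDiffAt ℝ 2 (g n) x := fun n x hx =>
    (ContDiffAt.sum fun i _ => (hv n i x hx).pow 2).sub (hw1 x hx)
  have hexists : ∀ n, ∃ x ∈ Metric.closedBall x₀ r, IsMaxOn (g n) (Metric.closedBall x₀ r) x :=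
    fun n => (isCompact_closedBall x₀ r).exists_isMaxOn ⟨x₀, Metric.mem_closedBall_self hr0.le⟩
      fun x hx => (hg n x hx).continuousAt.continuousWithinAt
  choose x hxmem hxmax using hexists
  obtain ⟨y, hy, φ, hφ, hxy⟩ := (isCompact_closedBall x₀ r).tendsto_subseq hxmem
  have hhφ : Tendsto (fun n => h (φ n)) atTop (𝓝 0) := hh.comp hφ.tendsto_atTop
  have hne : ∀ᶠ n in atTop, h (φ n) ≠ 0 := Eventually.of_forall fun n => (hpos _).ne'
  have hvlim : ∀ i (a : ℕ → E) (a₀ : E), a₀ ∈ Metric.closedBall x₀ r → Tendsto a atTop (𝓝 a₀) →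
      Tendsto (fun n => v (φ n) i (a n)) atTop (𝓝 (fderiv ℝ u a₀ (b i))) :=
    fun i a a₀ ha₀ ha => ((hu1 a₀ ha₀).hasStrictFDerivAt (by simp)).tendsto_difference_quotient
      ha hhφ hne (b i)
  have hglim : ∀ (a : ℕ → E) (a₀ : E), a₀ ∈ Metric.closedBall x₀ r → Tendsto a atTop (𝓝 a₀) →
      Tendsto (fun n => g (φ n) (a n)) atTop (𝓝 (‖∇ u a₀‖ ^ 2 - w a₀)) := by
    intro a a₀ ha₀ ha
    rw [← sum_sq_fderiv_eq_norm_gradient_sq b]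
    exact (tendsto_finsetSum _ fun i _ => (hvlim i a a₀ ha₀ ha).pow 2).sub
      ((hw1 a₀ ha₀).continuousAt.tendsto.comp ha)
  have hx₀ := Metric.mem_closedBall_self (x := x₀) hr0.le
  -- A limit of maximizers of `g (φ n)` maximizes the limit function |∇u|² - w, whose maximum is
  -- strict.
  have hyx : y = x₀ := by
    by_contra hyne
    have h1 := le_of_tendsto_of_tendsto' (hglim (fun _ => x₀) x₀ hx₀ tendsto_const_nhds)
      (hglim (x ∘ φ) y hy hxy) fun n => hxmax (φ n) hx₀
    exact absurd ((hball y (hsub y hy)).2.2.2 hyne) (not_lt.2 h1)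
  subst hyx
  -- Discrete Bochner formula: Δ(v²) = 2|∇v|² + 2vΔv for each quotient v, and Δv is the quotient of
  -- -f, so no third derivative of u appears.
  have hle : ∀ᶠ n in atTop, ∑ i, (2 * ∑ j, ((h (φ n))⁻¹ * (fderiv ℝ u (x (φ n) + h (φ n) • b i) (b j)
      - fderiv ℝ u (x (φ n)) (b j))) ^ 2 + 2 * v (φ n) i (x (φ n)) *
        (-((h (φ n))⁻¹ * (f (x (φ n) + h (φ n) • b i) - f (x (φ n))))))
      ≤ Laplacian.laplacian w (x (φ n)) := by
    filter_upwards [hxy.eventually (Metric.ball_mem_nhds y hr0)] with n hn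
    have hm := hxmem (φ n)
    have hloc : IsLocalMax (g (φ n)) (x (φ n)) :=
      (hxmax (φ n)).isLocalMax (Filter.mem_of_superset (Metric.isOpen_ball.mem_nhds hn)
        Metric.ball_subset_closedBall)
    have h1 := hloc.laplacian_nonpos (hg _ _ hm)
    have h2 : Laplacian.laplacian (g (φ n)) (x (φ n)) = _ :=
      (ContDiffAt.sum fun i _ => (hv (φ n) i _ hm).pow 2).laplacian_sub (hw1 _ hm)
    rw [laplacian_finset_sum _ fun i _ => (hv (φ n) i _ hm).pow 2] at h2
    rw [h2, sub_nonpos] at h1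
    refine le_trans (le_of_eq (Finset.sum_congr rfl fun i _ => ?_)) h1
    rw [laplacian_sq (hv (φ n) i _ hm), ← sum_sq_fderiv_eq_norm_gradient_sq b,
      laplacian_differenceQuotient (hu1 _ hm) (hu2 _ _ _ hm),
      (hball _ (hsub _ hm)).2.1, (hball _ (hshift (φ n) i _ hm)).2.1,
      Finset.sum_congr rfl fun j _ =>
        congrArg (· ^ 2) (fderiv_differenceQuotient (hu1 _ hm) (hu2 _ i _ hm) (b j))]
    ring
  have hlim := fun i => (hvlim i (x ∘ φ) y hy hxy)
  -- The base points move with n, which is why strict differentiability of the derivative is needed.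
  have hlim' : ∀ i j, Tendsto (fun n => (h (φ n))⁻¹ * (fderiv ℝ u (x (φ n) + h (φ n) • b i) (b j)
      - fderiv ℝ u (x (φ n)) (b j))) atTop (𝓝 (fderiv ℝ (fderiv ℝ u) y (b i) (b j))) := by
    intro i j
    have hs := (hu.contDiffAt_fderiv_of_two.hasStrictFDerivAt (by simp))
    have hs' := ((ContinuousLinearMap.apply ℝ ℝ (b j)).hasStrictFDerivAt).comp y hs
    exact hs'.tendsto_difference_quotient hxy hhφ hne (b i)
  have hf' : f' (∇ u y) = ∑ i, fderiv ℝ u y (b i) * f' (b i) := by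
    conv_lhs => rw [← b.sum_repr (∇ u y)]
    rw [map_sum]
    refine Finset.sum_congr rfl fun i _ => ?_
    rw [map_smul, smul_eq_mul, b.repr_apply_apply, ← toDual_gradient,
      InnerProductSpace.toDual_apply_apply, real_inner_comm]
  have hfin := le_of_tendsto_of_tendsto (tendsto_finsetSum Finset.univ fun i _ =>
    (((tendsto_finsetSum Finset.univ fun j _ => (hlim' i j).pow 2).const_mul 2).add
      (((hlim i).const_mul 2).mul
        (hf.tendsto_difference_quotient hxy hhφ hne (b i)).neg)))
    (hw.continuousAt_laplacian.tendsto.comp hxy) hle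
  rw [hf', Finset.mul_sum, Finset.mul_sum, ← Finset.sum_sub_distrib]
  refine le_trans (le_of_eq (Finset.sum_congr rfl fun i _ => ?_)) hfin
  ring

/-- Adding δ‖x - x₀‖² to w makes the maximum strict and changes Δw by δ times a constant; then δ →
0. -/
theorem bochner_le_laplacian_of_isLocalMax (b : OrthonormalBasis ι ℝ E) {u f w : E → ℝ} {x₀ : E}
    {f' : E →L[ℝ] ℝ} (hu : ContDiffAt ℝ 2 u x₀)
    (hΔ : ∀ᶠ x in 𝓝 x₀, Laplacian.laplacian u x = -f x) (hf : HasStrictFDerivAt f f' x₀)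
    (hw : ContDiffAt ℝ 2 w x₀) (hmax : IsLocalMax (fun x => ‖∇ u x‖ ^ 2 - w x) x₀) :
    2 * ∑ i, ∑ j, fderiv ℝ (fderiv ℝ u) x₀ (b i) (b j) ^ 2 - 2 * f' (∇ u x₀)
      ≤ Laplacian.laplacian w x₀ := by
  have hδ : ∀ δ > 0, 2 * ∑ i, ∑ j, fderiv ℝ (fderiv ℝ u) x₀ (b i) (b j) ^ 2 - 2 * f' (∇ u x₀)
      ≤ Laplacian.laplacian w x₀ + δ * (2 * Module.finrank ℝ E) := by
    intro δ hδ
    have hsq := (contDiff_norm_sub_sq x₀).contDiffAt (x := x₀)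
    have hsq' : ContDiffAt ℝ 2 (δ • fun y => ‖y - x₀‖ ^ 2) x₀ := contDiffAt_const.smul hsq
    have := bochner_le_laplacian_of_strict_max (w := w + δ • fun y => ‖y - x₀‖ ^ 2) b hu hΔ hf
        (hw.add hsq') <| by
      filter_upwards [hmax] with x hx hne
      have : 0 < ‖x - x₀‖ := norm_pos_iff.2 (sub_ne_zero.2 hne)
      have : 0 < δ * ‖x - x₀‖ ^ 2 := by positivity
      simp only [Pi.add_apply, Pi.smul_apply, smul_eq_mul, sub_self, norm_zero]
      linarith
    rwa [hw.laplacian_add hsq', InnerProductSpace.laplacian_smul _ hsq, laplacian_norm_sub_sq,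
      smul_eq_mul] at this
  have hlim : Tendsto (fun δ : ℝ => Laplacian.laplacian w x₀ + δ * (2 * Module.finrank ℝ E))
      (𝓝[>] 0) (𝓝 (Laplacian.laplacian w x₀)) := by
    have : ContinuousAt
        (fun δ : ℝ => Laplacian.laplacian w x₀ + δ * (2 * Module.finrank ℝ E)) 0 := by fun_prop
    simpa using this.tendsto.mono_left nhdsWithin_le_nhds
  exact ge_of_tendsto hlim (by filter_upwards [self_mem_nhdsWithin] with δ h using hδ δ h)

/-- Cauchy–Schwarz on the trace, after which the off-diagonal squares are only extra. -/
theorem laplacian_sq_le_card_mul_sum (b : OrthonormalBasis ι ℝ E) (u : E → ℝ) (x : E) :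
    Laplacian.laplacian u x ^ 2 ≤
      Fintype.card ι * ∑ i, ∑ j, fderiv ℝ (fderiv ℝ u) x (b i) (b j) ^ 2 := by
  rw [laplacian_eq_sum_fderiv_fderiv b]
  refine sq_sum_le_card_mul_sum_sq.trans ?_
  rw [Finset.card_univ]
  gcongr with i
  exact Finset.single_le_sum (f := fun j => fderiv ℝ (fderiv ℝ u) x (b i) (b j) ^ 2)
    (fun j _ => sq_nonneg _) (Finset.mem_univ i)

end Bochner

/-! ### Inequalities between real numbers. -/

section Scalar

/-- Young's inequality in the form that absorbs the reaction term. -/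
theorem mul_rpow_mul_sq_le {p A U g : ℝ} (hp : 1 < p) (hA : 0 ≤ A) (hU : 0 ≤ U) (hg : 0 ≤ g) :
    A * (U ^ (p - 1) * g ^ 2) ≤
      (U ^ p) ^ 2 + A ^ (2 * p / (p + 1)) * (g ^ (2 * p / (p + 1))) ^ 2 := by
  have hp1 : p - 1 ≠ 0 := by linarith
  have hp2 : p + 1 ≠ 0 := by linarith
  have hp0 : p ≠ 0 := by linarith
  -- The first exponent turns U^(p-1) into U^(2p); its conjugate fixes the power of g. Both exceed
  -- 1, so the divisions in Young's inequality can be dropped.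
  have hc : (2 * p / (p - 1)).HolderConjugate (2 * p / (p + 1)) := by
    rw [Real.holderConjugate_iff]
    refine ⟨by rw [lt_div_iff₀] <;> linarith, ?_⟩
    field_simp
    ring
  have hy := Real.young_inequality_of_nonneg (a := U ^ (p - 1)) (b := A * g ^ 2)
    (by positivity) (by positivity) hc
  have h1 : (U ^ (p - 1)) ^ (2 * p / (p - 1)) = (U ^ p) ^ 2 := by
    rw [← Real.rpow_natCast, ← Real.rpow_mul hU, ← Real.rpow_mul hU]
    congr 1
    push_cast
    field_simp
  have h2 : (A * g ^ 2) ^ (2 * p / (p + 1)) =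
      A ^ (2 * p / (p + 1)) * (g ^ (2 * p / (p + 1))) ^ 2 := by
    rw [Real.mul_rpow hA (by positivity), ← Real.rpow_natCast, ← Real.rpow_natCast,
      ← Real.rpow_mul hg, ← Real.rpow_mul hg, mul_comm (2 * p / (p + 1))]
  rw [h1, h2] at hy
  have h3 := div_le_self (a := (U ^ p) ^ 2) (by positivity) hc.lt.le
  have h4 := div_le_self (a := A ^ (2 * p / (p + 1)) * (g ^ (2 * p / (p + 1))) ^ 2)
    (by positivity) hc.symm.lt.le
  linarith

theorem le_rpow_mul_rpow_of_mul_rpow_le {s a b K g : ℝ} (hs : 0 < s) (hb : 0 < b)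
    (hK : 0 ≤ K) (ha : 0 ≤ a) (hg : 0 ≤ g) (h : b * g ^ s ≤ K * a) :
    g ≤ K ^ (1 / s) * (a / b) ^ (1 / s) := by
  have h1 : g ^ s ≤ K * (a / b) := by
    rw [← mul_div_assoc, le_div_iff₀ hb]; linarith
  calc g = (g ^ s) ^ (1 / s) := by
        rw [← Real.rpow_mul hg, mul_one_div_cancel hs.ne', Real.rpow_one]
    _ ≤ (K * (a / b)) ^ (1 / s) := by gcongr
    _ = _ := Real.mul_rpow hK (by positivity)

/-- The algebraic inequality satisfied at a maximum point gives the bound there. -/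
theorem exists_le_of_bernstein_inequality {p q A B D : ℝ} (hp : 1 < p)
    (hq : 2 * p / (p + 1) < q) (hA : 0 ≤ A) (hB : 0 ≤ B) (hD : 0 ≤ D) :
    ∃ C : ℝ, 0 < C ∧ ∀ M U g S : ℝ, 0 < M → 0 ≤ U → 0 < g → 0 < S →
      (U ^ p + M * g ^ q) ^ 2 ≤
        A * (U ^ (p - 1) * g ^ 2) + B * (M * g ^ (q + 1) * S) + D * (g ^ 2 * S ^ 2) →
      g ≤ C * (M ^ (-(p + 1) / ((p + 1) * q - 2 * p)) + (S / M) ^ (1 / (q - 1))) := by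
  set a := 2 * p / (p + 1) with ha
  have ha1 : 1 < a := by rw [ha, lt_div_iff₀] <;> linarith
  have hq1 : 0 < q - 1 := by linarith
  have hqa : 0 < q - a := by linarith
  set C₁ := 3 * A ^ a with hC₁
  have hC₁0 : 0 ≤ C₁ := by positivity
  -- One constant for each of the three cases below; the final 1 keeps the sum positive when A, B
  -- and D vanish.
  refine ⟨(√C₁) ^ (1 / (q - a)) + (3 * B) ^ (1 / (q - 1)) + (√(3 * D)) ^ (1 / (q - 1)) + 1,
    by positivity, fun M U g S hM hU hg hS h => ?_⟩
  have hα : M ^ (-(p + 1) / ((p + 1) * q - 2 * p)) = (1 / M) ^ (1 / (q - a)) := by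
    have hp2 : p + 1 ≠ 0 := by linarith
    have : q - a = ((p + 1) * q - 2 * p) / (p + 1) := by rw [ha]; field_simp
    rw [this, one_div_div, one_div, Real.inv_rpow hM.le, ← Real.rpow_neg hM.le, neg_div]
  rw [hα]
  have hX : 0 < (1 / M) ^ (1 / (q - a)) := by positivity
  have hY : 0 < (S / M) ^ (1 / (q - 1)) := by positivity
  have hK₁ : 0 ≤ (√C₁) ^ (1 / (q - a)) := by positivity
  have hK₂ : 0 ≤ (3 * B) ^ (1 / (q - 1)) := by positivity
  have hK₃ : 0 ≤ (√(3 * D)) ^ (1 / (q - 1)) := by positivity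
  have hy := mul_rpow_mul_sq_le hp hA hU hg.le
  rw [← ha] at hy
  have hUp : 0 ≤ U ^ p := by positivity
  have hgq : 0 < g ^ q := by positivity
  -- The term (U^p)² from Young's inequality cancels the one in the expanded square, whose cross
  -- term is nonnegative.
  have hmain : (M * g ^ q) ^ 2 ≤ A ^ a * (g ^ a) ^ 2 + B * (M * g ^ (q + 1) * S)
      + D * (g ^ 2 * S ^ 2) := by
    have : 0 ≤ U ^ p * (M * g ^ q) := by positivity
    nlinarith
  have e1 : g ^ q = g ^ a * g ^ (q - a) := by rw [← Real.rpow_add hg]; congr 1; ring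
  have e2 : g ^ q = g * g ^ (q - 1) := by
    rw [← Real.rpow_one_add' hg.le (by linarith)]; congr 1; ring
  have e3 : g ^ (q + 1) = g ^ q * g := Real.rpow_add_one hg.ne' q
  -- One of the three summands is at least a third of the total.
  have hcases : (M * g ^ q) ^ 2 ≤ C₁ * (g ^ a) ^ 2 ∨
      (M * g ^ q) ^ 2 ≤ 3 * B * (M * g ^ (q + 1) * S) ∨
      (M * g ^ q) ^ 2 ≤ 3 * D * (g ^ 2 * S ^ 2) := by
    by_contra! hcon
    obtain ⟨h1, h2, h3⟩ := hcon
    rw [hC₁] at h1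
    linarith
  rcases hcases with h1 | h2 | h3
  · have : M * g ^ (q - a) ≤ √C₁ * 1 := by
      have hga : 0 < g ^ a := by positivity
      have : (M * g ^ (q - a)) ^ 2 ≤ C₁ := by
        have h' : (M * g ^ (q - a)) ^ 2 * (g ^ a) ^ 2 ≤ C₁ * (g ^ a) ^ 2 := by
          rw [e1] at h1; linarith
        exact le_of_mul_le_mul_right h' (by positivity)
      rw [mul_one]
      exact Real.le_sqrt_of_sq_le this
    have := le_rpow_mul_rpow_of_mul_rpow_le hqa hM (by positivity) zero_le_one hg.le this
    nlinarith
  · have : M * g ^ (q - 1) ≤ 3 * B * S := by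
      have h' : M * g ^ (q - 1) * (M * g ^ q * g) ≤ 3 * B * S * (M * g ^ q * g) := by
        rw [e3] at h2
        calc _ = (M * g ^ q) * (M * (g * g ^ (q - 1))) := by ring
          _ = (M * g ^ q) ^ 2 := by rw [← e2]; ring
          _ ≤ _ := h2
          _ = _ := by ring
      exact le_of_mul_le_mul_right h' (by positivity)
    have := le_rpow_mul_rpow_of_mul_rpow_le hq1 hM (by positivity) hS.le hg.le this
    nlinarith
  · have : M * g ^ (q - 1) ≤ √(3 * D) * S := by
      have : (M * g ^ (q - 1)) ^ 2 ≤ 3 * D * S ^ 2 := by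
        have h' : (M * g ^ (q - 1)) ^ 2 * g ^ 2 ≤ 3 * D * S ^ 2 * g ^ 2 := by
          rw [e2] at h3; linarith
        exact le_of_mul_le_mul_right h' (by positivity)
      have h' := Real.le_sqrt_of_sq_le this
      rwa [Real.sqrt_mul (by positivity), Real.sqrt_sq hS.le] at h'
    have := le_rpow_mul_rpow_of_mul_rpow_le hq1 hM (by positivity) hS.le hg.le this
    nlinarith

end Scalar

/-! ### The radial barrier blowing up on a sphere. -/

section Barrier

variable {E : Type*} [NormedAddCommGroup E] [InnerProductSpace ℝ E]

theorem contDiffAt_barrier {m R k : ℝ} {a x : E} (hx : ‖x - a‖ ^ 2 < R ^ 2) :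
    ContDiffAt ℝ 2 (fun y => m * (R ^ 2 - ‖y - a‖ ^ 2) ^ (-k)) x :=
  contDiffAt_const.mul ((contDiffAt_const.sub (contDiff_norm_sub_sq a).contDiffAt).rpow_const_of_ne
    (sub_pos.2 hx).ne')

variable [FiniteDimensional ℝ E]

theorem gradient_comp {v : E → ℝ} {x : E} {F : ℝ → ℝ} {F' : ℝ} (hF : HasDerivAt F F' (v x))
    (hv : DifferentiableAt ℝ v x) : ∇ (fun y => F (v y)) x = F' • ∇ v x := by
  apply (InnerProductSpace.toDual ℝ E).injective
  rw [map_smul, toDual_gradient, toDual_gradient]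
  exact (hF.comp_hasFDerivAt x hv.hasFDerivAt).fderiv

theorem hasDerivAt_barrier {m c k s : ℝ} (hs : s < c) :
    HasDerivAt (fun s => m * (c - s) ^ (-k)) (m * k * (c - s) ^ (-(k + 1))) s := by
  have h : HasDerivAt (fun s => c - s) (-1) s := by simpa using (hasDerivAt_id s).const_sub c
  refine ((h.rpow_const (p := -k) (Or.inl (sub_pos.2 hs).ne')).const_mul m).congr_deriv ?_
  rw [show -(k + 1) = -k - 1 by ring]
  ring

theorem rpow_neg_add_one_eq {t k : ℝ} (ht : 0 < t) : t ^ (-(k + 1)) = t ^ (-k) / t := by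
  rw [neg_add, ← sub_eq_add_neg, Real.rpow_sub_one ht.ne']

theorem norm_gradient_barrier_le {m R k : ℝ} (hm : 0 ≤ m) (hR : 0 ≤ R) (hk : 0 ≤ k) {a x : E}
    (hx : ‖x - a‖ ^ 2 < R ^ 2) :
    ‖∇ (fun y => m * (R ^ 2 - ‖y - a‖ ^ 2) ^ (-k)) x‖ ≤
      2 * k * (m * (R ^ 2 - ‖x - a‖ ^ 2) ^ (-k)) * (R / (R ^ 2 - ‖x - a‖ ^ 2)) := by
  have ht : 0 < R ^ 2 - ‖x - a‖ ^ 2 := sub_pos.2 hx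
  have hxR : ‖x - a‖ ≤ R := abs_le_of_sq_le_sq' hx.le hR |>.2
  rw [gradient_comp (v := fun y => ‖y - a‖ ^ 2) (hasDerivAt_barrier hx)
    ((contDiff_norm_sub_sq a).contDiffAt.differentiableAt (by simp)), norm_smul,
    norm_gradient_norm_sub_sq, Real.norm_of_nonneg (by positivity), rpow_neg_add_one_eq ht]
  have : 0 ≤ m * k * ((R ^ 2 - ‖x - a‖ ^ 2) ^ (-k) / (R ^ 2 - ‖x - a‖ ^ 2)) := by positivity
  calc _ ≤ m * k * ((R ^ 2 - ‖x - a‖ ^ 2) ^ (-k) / (R ^ 2 - ‖x - a‖ ^ 2)) * (2 * R) := by gcongr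
    _ = _ := by ring

/-- With t = R² - |x-a|² ≤ R², both 1/t and (|x-a|/t)² are at most (R/t)², so the two terms of the
radial Laplacian share one scale. -/
theorem laplacian_barrier_le {m R k : ℝ} (hm : 0 ≤ m) (hk : 0 ≤ k) {a x : E}
    (hx : ‖x - a‖ ^ 2 < R ^ 2) :
    Laplacian.laplacian (fun y => m * (R ^ 2 - ‖y - a‖ ^ 2) ^ (-k)) x ≤
      (4 * k * (k + 1) + 2 * k * Module.finrank ℝ E) * (m * (R ^ 2 - ‖x - a‖ ^ 2) ^ (-k)) *
        (R / (R ^ 2 - ‖x - a‖ ^ 2)) ^ 2 := by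
  have ht : 0 < R ^ 2 - ‖x - a‖ ^ 2 := sub_pos.2 hx
  have hev : ∀ᶠ s in 𝓝 (‖x - a‖ ^ 2), HasDerivAt (fun s => m * (R ^ 2 - s) ^ (-k))
      (m * k * (R ^ 2 - s) ^ (-(k + 1))) s := by
    filter_upwards [Iio_mem_nhds hx] with s hs using hasDerivAt_barrier hs
  rw [laplacian_comp (v := fun y => ‖y - a‖ ^ 2) (contDiff_norm_sub_sq a).contDiffAt hev
    (hasDerivAt_barrier hx), norm_gradient_norm_sub_sq, laplacian_norm_sub_sq,
    rpow_neg_add_one_eq ht, rpow_neg_add_one_eq ht]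
  set t := R ^ 2 - ‖x - a‖ ^ 2 with ht'
  have hW : 0 ≤ m * t ^ (-k) := by positivity
  have h1 : 1 / t ≤ (R / t) ^ 2 := by
    rw [div_pow, div_le_div_iff₀ ht (by positivity)]
    nlinarith [sq_nonneg ‖x - a‖]
  have h2 : (‖x - a‖ / t) ^ 2 ≤ (R / t) ^ 2 := by
    rw [div_pow, div_pow]; gcongr
  calc _ = m * t ^ (-k) * (4 * k * (k + 1)) * (‖x - a‖ / t) ^ 2
        + m * t ^ (-k) * (2 * k * Module.finrank ℝ E) * (1 / t) := by
        field_simp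
        ring
    _ ≤ m * t ^ (-k) * (4 * k * (k + 1)) * (R / t) ^ 2
        + m * t ^ (-k) * (2 * k * Module.finrank ℝ E) * (R / t) ^ 2 := by gcongr
    _ = _ := by ring

end Barrier

/-! ### The Bernstein argument in a ball. -/

section Bernstein

variable {E : Type*} [NormedAddCommGroup E] [InnerProductSpace ℝ E] [FiniteDimensional ℝ E]

theorem ContDiffAt.gradient {u : E → ℝ} {x : E} (hu : ContDiffAt ℝ 2 u x) :
    ContDiffAt ℝ 1 (∇ u) x :=
  (InnerProductSpace.toDual ℝ E).symm.toContinuousLinearEquiv.contDiff.contDiffAt.comp x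
    hu.contDiffAt_fderiv_of_two

theorem fderiv_apply_gradient (u : E → ℝ) (x : E) : fderiv ℝ u x (∇ u x) = ‖∇ u x‖ ^ 2 := by
  rw [← toDual_gradient, InnerProductSpace.toDual_apply_apply, real_inner_self_eq_norm_sq]

/-- The Bernstein inequality at a point where `‖∇ u‖ ^ 2 - w` has a local maximum. -/
theorem bernstein_inequality_of_isLocalMax {p q M : ℝ} (hp : 1 < p) (hq : 0 < q) (hM : 0 < M)
    {u w : E → ℝ} {x : E} (hu : ContDiffAt ℝ 2 u x)
    (heq : ∀ᶠ y in 𝓝 x, -(Laplacian.laplacian u y) = u y ^ p + M * ‖∇ u y‖ ^ q)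
    (hgrad : 0 < ‖∇ u x‖) (hw : ContDiffAt ℝ 2 w x)
    (hmax : IsLocalMax (fun y => ‖∇ u y‖ ^ 2 - w y) x) :
    (u x ^ p + M * ‖∇ u x‖ ^ q) ^ 2 ≤ Module.finrank ℝ E * (p * (u x ^ (p - 1) * ‖∇ u x‖ ^ 2) +
      M * (q / 2) * (‖∇ u x‖ ^ (q - 1) * ‖∇ w x‖) + Laplacian.laplacian w x / 2) := by
  have hz : ContDiffAt ℝ 1 (fun y => ‖∇ u y‖ ^ 2) x := hu.gradient.norm_sq ℝ
  -- The first-order condition removes the second derivatives of u from ⟨∇f, ∇u⟩.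
  have hzw : fderiv ℝ (fun y => ‖∇ u y‖ ^ 2) x = fderiv ℝ w x := by
    have h1 := hmax.fderiv_eq_zero
    have h2 := ((hz.differentiableAt (by simp)).hasFDerivAt.sub
      (hw.differentiableAt (by simp)).hasFDerivAt).fderiv
    exact sub_eq_zero.1 (h2.symm.trans h1)
  have hpow : ∀ y, (‖∇ u y‖ ^ 2) ^ (q / 2) = ‖∇ u y‖ ^ q := fun y => by
    rw [← Real.rpow_natCast, ← Real.rpow_mul (norm_nonneg _)]
    congr 1
    push_cast
    ring
  -- Writing |∇u|^q as z^(q/2) uses only that z is C¹ and nonzero at x; p ≥ 1 allows u x = 0.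
  have hf := ((hu.hasStrictFDerivAt (by simp)).rpow_const (p := p) (Or.inr hp.le)).add
    (((hz.hasStrictFDerivAt (by simp)).rpow_const (p := q / 2)
      (Or.inl (pow_pos hgrad 2).ne')).const_mul M)
  have hΔ : ∀ᶠ y in 𝓝 x, Laplacian.laplacian u y =
      -(u y ^ p + M * (‖∇ u y‖ ^ 2) ^ (q / 2)) := by
    filter_upwards [heq] with y hy
    rw [hpow, ← hy, neg_neg]
  have hb := bochner_le_laplacian_of_isLocalMax (stdOrthonormalBasis ℝ E) hu hΔ hf hw hmax
  have hc := laplacian_sq_le_card_mul_sum (stdOrthonormalBasis ℝ E) u x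
  rw [Fintype.card_fin] at hc
  have hx := heq.self_of_nhds
  have hdw : fderiv ℝ w x (∇ u x) ≤ ‖∇ w x‖ * ‖∇ u x‖ := by
    rw [← toDual_gradient, InnerProductSpace.toDual_apply_apply]
    exact real_inner_le_norm _ _
  have hqpow : (‖∇ u x‖ ^ 2) ^ (q / 2 - 1) * ‖∇ u x‖ = ‖∇ u x‖ ^ (q - 1) := by
    rw [← Real.rpow_natCast, ← Real.rpow_mul (norm_nonneg _), ← Real.rpow_add_one hgrad.ne']
    congr 1
    push_cast
    ring
  rw [hzw] at hb
  simp only [add_apply, smul_apply, smul_eq_mul,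
    fderiv_apply_gradient] at hb
  set Z := (‖∇ u x‖ ^ 2) ^ (q / 2 - 1)
  have hZ : 0 ≤ Z := by positivity
  have h1 : M * (q / 2 * Z * fderiv ℝ w x (∇ u x)) ≤
      M * (q / 2) * (‖∇ u x‖ ^ (q - 1) * ‖∇ w x‖) := by
    calc _ ≤ M * (q / 2 * Z * (‖∇ w x‖ * ‖∇ u x‖)) := by gcongr
      _ = _ := by rw [← hqpow]; ring
  rw [← hx, neg_sq]
  refine hc.trans ?_
  gcongr
  linarith

/-- The interior gradient estimate in a closed ball. -/
theorem exists_norm_gradient_le_of_closedBall (E : Type*) [NormedAddCommGroup E]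
    [InnerProductSpace ℝ E] [FiniteDimensional ℝ E] {p q : ℝ} (hp : 1 < p)
    (hq : 2 * p / (p + 1) < q) :
    ∃ C : ℝ, 0 < C ∧ ∀ (M : ℝ) (u : E → ℝ) (a : E) (R : ℝ), 0 < M → 0 < R →
      (∀ x ∈ Metric.closedBall a R, ContDiffAt ℝ 2 u x ∧ 0 ≤ u x ∧
        -(Laplacian.laplacian u x) = u x ^ p + M * ‖∇ u x‖ ^ q) →
      ‖∇ u a‖ ≤ C * (M ^ (-(p + 1) / ((p + 1) * q - 2 * p)) + (M * R) ^ (-1 / (q - 1))) := by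
  have hq1 : 1 < q := lt_trans (by rw [lt_div_iff₀] <;> linarith) hq
  have hq1' : 0 < q - 1 := by linarith
  set β := 1 / (q - 1) with hβ
  have hβ0 : 0 < β := by positivity
  set n : ℝ := (Module.finrank ℝ E : ℝ) with hn
  -- A, B and D come from the Bernstein inequality with the barrier bounds for k = 2β inserted; S
  -- will be R/t.
  obtain ⟨C, hC, hmain⟩ := exists_le_of_bernstein_inequality (A := n * p) (B := 2 * n * q * β)
    (D := n * (4 * β * (2 * β + 1) + 2 * β * n)) hp hq (by positivity) (by positivity)
    (by positivity)
  refine ⟨C, hC, fun M u a R hM hR hu => ?_⟩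
  rcases (norm_nonneg (∇ u a)).eq_or_lt with h0 | h0
  · rw [← h0]; positivity
  have ha : a ∈ Metric.closedBall a R := Metric.mem_closedBall_self hR.le
  have hcont : ContinuousOn (fun x => (R ^ 2 - ‖x - a‖ ^ 2) ^ β * ‖∇ u x‖)
      (Metric.closedBall a R) := by
    intro x hx
    have h1 : ContinuousAt (fun x => (R ^ 2 - ‖x - a‖ ^ 2)) x := by fun_prop
    exact ((h1.rpow_const (Or.inr hβ0.le)).mul
      (hu x hx).1.gradient.continuousAt.norm).continuousWithinAt
  obtain ⟨x, hx, hxmax⟩ := (isCompact_closedBall a R).exists_isMaxOn ⟨a, ha⟩ hcont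
  have hax : (R ^ 2) ^ β * ‖∇ u a‖ ≤ (R ^ 2 - ‖x - a‖ ^ 2) ^ β * ‖∇ u x‖ := by
    simpa using hxmax ha
  have hpos : 0 < (R ^ 2 - ‖x - a‖ ^ 2) ^ β * ‖∇ u x‖ := lt_of_lt_of_le (by positivity) hax
  rw [Metric.mem_closedBall, dist_eq_norm] at hx
  have ht0 : 0 ≤ R ^ 2 - ‖x - a‖ ^ 2 := sub_nonneg.2 (by gcongr)
  have hg : 0 < ‖∇ u x‖ := pos_of_mul_pos_right hpos (by positivity)
  -- The weight vanishes on the sphere, whereas the maximum is positive, so x is interior.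
  have ht : 0 < R ^ 2 - ‖x - a‖ ^ 2 := by
    refine ht0.lt_of_ne fun h => ?_
    rw [← h, Real.zero_rpow hβ0.ne', zero_mul] at hpos
    exact hpos.false
  have hxR : ‖x - a‖ ^ 2 < R ^ 2 := sub_pos.1 ht
  have hball : Metric.closedBall a R ∈ 𝓝 x := by
    refine Filter.mem_of_superset (Metric.isOpen_ball.mem_nhds ?_) Metric.ball_subset_closedBall
    rw [Metric.mem_ball, dist_eq_norm]
    exact lt_of_pow_lt_pow_left₀ 2 hR.le hxR
  -- The square of the maximum: then w ≥ |∇u|² inside the ball, with equality at x.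
  set m := ((R ^ 2 - ‖x - a‖ ^ 2) ^ β * ‖∇ u x‖) ^ 2 with hm
  let w : E → ℝ := fun y => m * (R ^ 2 - ‖y - a‖ ^ 2) ^ (-(2 * β))
  have hpow : ∀ t : ℝ, 0 < t → t ^ (-(2 * β)) = ((t ^ β) ^ 2)⁻¹ := fun t ht => by
    rw [Real.rpow_neg ht.le, mul_comm, Real.rpow_mul ht.le, Real.rpow_two]
  have hwx : w x = ‖∇ u x‖ ^ 2 := by
    have := Real.rpow_pos_of_pos ht β
    simp only [w, hm, hpow _ ht]
    field_simp
  have hmax : IsLocalMax (fun y => ‖∇ u y‖ ^ 2 - w y) x := by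
    have hev : ∀ᶠ y in 𝓝 x, 0 < R ^ 2 - ‖y - a‖ ^ 2 := by
      have h1 : ContinuousAt (fun y => R ^ 2 - ‖y - a‖ ^ 2) x := by fun_prop
      exact h1.eventually (lt_mem_nhds ht)
    filter_upwards [hball, hev] with y hy hty
    have h1 : (R ^ 2 - ‖y - a‖ ^ 2) ^ β * ‖∇ u y‖ ≤ _ := hxmax hy
    have h2 := Real.rpow_pos_of_pos hty β
    rw [hwx, sub_self, sub_nonpos]
    simp only [w, hpow _ hty]
    rw [← div_eq_mul_inv, le_div_iff₀ (by positivity), hm]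
    calc _ = ((R ^ 2 - ‖y - a‖ ^ 2) ^ β * ‖∇ u y‖) ^ 2 := by ring
      _ ≤ _ := by gcongr
  have hxmem := mem_of_mem_nhds hball
  have hineq := bernstein_inequality_of_isLocalMax hp (zero_lt_one.trans hq1) hM (hu x hxmem).1
    (by filter_upwards [hball] with y hy using (hu y hy).2.2) hg
    (contDiffAt_barrier hxR) hmax
  have hgw := norm_gradient_barrier_le (m := m) (k := 2 * β) (by positivity) hR.le
    (by positivity) hxR
  have hlw := laplacian_barrier_le (m := m) (k := 2 * β) (by positivity) (by positivity) hxR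
  change ‖∇ w x‖ ≤ 2 * (2 * β) * w x * _ at hgw
  change Laplacian.laplacian w x ≤ _ * w x * _ at hlw
  change _ ≤ n * (_ + _ * (_ * ‖∇ w x‖) + Laplacian.laplacian w x / 2) at hineq
  rw [hwx] at hgw hlw
  set t := R ^ 2 - ‖x - a‖ ^ 2
  set g := ‖∇ u x‖
  have hgq : g ^ (q + 1) = g ^ (q - 1) * g ^ 2 := by
    rw [← Real.rpow_two, ← Real.rpow_add hg]; congr 1; ring
  have hbound := hmain M (u x) g (R / t) hM (hu x hxmem).2.1 hg (by positivity) <| by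
    refine hineq.trans ?_
    calc _ ≤ n * (p * (u x ^ (p - 1) * g ^ 2) +
          M * (q / 2) * (g ^ (q - 1) * (2 * (2 * β) * g ^ 2 * (R / t))) +
          ((4 * (2 * β) * (2 * β + 1) + 2 * (2 * β) * n) * g ^ 2 * (R / t) ^ 2) / 2) := by
          gcongr
      _ = _ := by rw [hgq]; ring
  have htR : t ≤ R ^ 2 := sub_le_self _ (by positivity)
  have hRβ : 0 < (R ^ 2) ^ β := by positivity
  have hfinal : (R ^ 2) ^ β * ‖∇ u a‖ ≤ (R ^ 2) ^ β *
      (C * (M ^ (-(p + 1) / ((p + 1) * q - 2 * p)) + (M * R) ^ (-1 / (q - 1)))) := by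
    -- The unknown position t of the maximum drops out because the weight has exponent β = 1/(q-1).
    have e1 : t ^ β * (R / t / M) ^ β = (R / M) ^ β := by
      rw [← Real.mul_rpow ht.le (by positivity)]
      congr 1
      field_simp
    have e2 : (R ^ 2) ^ β * (M * R) ^ (-1 / (q - 1)) = (R / M) ^ β := by
      rw [neg_div, ← hβ, Real.rpow_neg (by positivity), ← Real.inv_rpow (by positivity),
        ← Real.mul_rpow (by positivity) (by positivity)]
      congr 1
      field_simp
    calc _ ≤ t ^ β * g := hax
      _ ≤ t ^ β * (C * (M ^ (-(p + 1) / ((p + 1) * q - 2 * p)) + (R / t / M) ^ β)) := by gcongr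
      _ = C * (t ^ β * M ^ (-(p + 1) / ((p + 1) * q - 2 * p)) + (R / M) ^ β) := by
        rw [← e1]; ring
      _ ≤ C * ((R ^ 2) ^ β * M ^ (-(p + 1) / ((p + 1) * q - 2 * p)) + (R / M) ^ β) := by gcongr
      _ = _ := by rw [← e2]; ring
  exact le_of_mul_le_mul_left hfinal hRβ

end Bernstein

/-! ### Balls and the distance to the frontier. -/

section Domains

/-- A ball centred in an open set that does not meet its frontier is contained in the set. -/
theorem ball_infDist_frontier_subset {E : Type*} [NormedAddCommGroup E] [NormedSpace ℝ E]
    {Ω : Set E} (hΩ : IsOpen Ω) {x : E} (hx : x ∈ Ω) :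
    Metric.ball x (Metric.infDist x (frontier Ω)) ⊆ Ω := by
  rcases le_or_gt (Metric.infDist x (frontier Ω)) 0 with h0 | h0
  · simp [Metric.ball_eq_empty.2 h0]
  -- By connectedness, a ball not inside Ω would contain a point of the closure outside Ω, hence a
  -- frontier point closer than the distance.
  refine (convex_ball x _).isPreconnected.subset_of_closure_inter_subset hΩ
    ⟨x, Metric.mem_ball_self h0, hx⟩ fun y ⟨hy, hyb⟩ => ?_
  by_contra hyΩ
  have hyf : y ∈ frontier Ω := by rw [hΩ.frontier_eq]; exact ⟨hy, hyΩ⟩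
  have := Metric.infDist_le_dist_of_mem (x := x) hyf
  rw [Metric.mem_ball, dist_comm] at hyb
  linarith

theorem infDist_frontier_pos {E : Type*} [NormedAddCommGroup E] [NormedSpace ℝ E]
    {Ω : Set E} (hΩ : IsOpen Ω) (hne : Ω ≠ Set.univ) {x : E} (hx : x ∈ Ω) :
    0 < Metric.infDist x (frontier Ω) := by
  have hfr : (frontier Ω).Nonempty := by
    rw [nonempty_frontier_iff]
    exact ⟨⟨x, hx⟩, hne⟩
  refine (isClosed_frontier.notMem_iff_infDist_pos hfr).1 ?_
  rw [hΩ.frontier_eq]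
  exact fun h => h.2 hx

end Domains

/-! ### The estimates in domains and in the whole space. -/

theorem IsSolution.contDiffAt_and_nonneg_and_equation {N : ℕ} {p q M : ℝ}
    {Ω : Set (EuclideanSpace ℝ (Fin N))} {u : EuclideanSpace ℝ (Fin N) → ℝ} (hΩ : IsOpen Ω)
    (h : IsSolution p q M Ω u) {x : EuclideanSpace ℝ (Fin N)} (hx : x ∈ Ω) :
    ContDiffAt ℝ 2 u x ∧ 0 ≤ u x ∧
      -(Laplacian.laplacian u x) = u x ^ p + M * ‖∇ u x‖ ^ q :=
  ⟨h.contDiffOn.contDiffAt (hΩ.mem_nhds hx), h.nonneg x hx, h.equation x hx⟩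

/-- If `Ω = ℝ^N` then `frontier Ω = ∅` and `Metric.infDist x ∅ = 0`, so that the last term of the
first estimate is `0 ^ (-1 / (q - 1)) = 0`: this is its value for the usual convention that the
distance to the empty set is infinite. In all other domains the distance is positive. -/
theorem theoremA (N : ℕ) (hN : 1 ≤ N) (p q : ℝ) (hp : 1 < p) (hq : 2 * p / (p + 1) < q) :
    ∃ c : ℝ, 0 < c ∧ ∀ M : ℝ, 0 < M →
      (∀ (Ω : Set (EuclideanSpace ℝ (Fin N))) (u : EuclideanSpace ℝ (Fin N) → ℝ),
        IsOpen Ω → IsConnected Ω → IsSolution p q M Ω u →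
          ∀ x ∈ Ω, ‖∇ u x‖ ≤ c * (M ^ (-(p + 1) / ((p + 1) * q - 2 * p)) +
            (M * Metric.infDist x (frontier Ω)) ^ (-1 / (q - 1)))) ∧
      (∀ u : EuclideanSpace ℝ (Fin N) → ℝ, IsGroundState p q M u →
        (∀ x, ‖∇ u x‖ ≤ c * M ^ (-(p + 1) / ((p + 1) * q - 2 * p))) ∧
        (∀ x, u x ≤ u 0 + c * M ^ (-(p + 1) / ((p + 1) * q - 2 * p)) * ‖x‖)) := by
  have hq1 : 1 < q := lt_trans (by rw [lt_div_iff₀] <;> linarith) hq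
  have hq1' : 0 < q - 1 := by linarith
  obtain ⟨C, hC, hball⟩ := exists_norm_gradient_le_of_closedBall (EuclideanSpace ℝ (Fin N)) hp hq
  -- The price of using radius d/2, whose closed ball lies in Ω.
  set K := (2 : ℝ) ^ (1 / (q - 1)) with hK
  have hK1 : 1 ≤ K := Real.one_le_rpow (by norm_num) (by positivity)
  have hCK : C ≤ C * K := le_mul_of_one_le_right hC.le hK1
  refine ⟨C * K, by positivity, fun M hM => ?_⟩
  have hglobal : ∀ u : EuclideanSpace ℝ (Fin N) → ℝ, IsSolution p q M Set.univ u →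
      ∀ x, ‖∇ u x‖ ≤ C * K * M ^ (-(p + 1) / ((p + 1) * q - 2 * p)) := by
    intro u hu x
    have hlim : Tendsto (fun R : ℝ => C * (M ^ (-(p + 1) / ((p + 1) * q - 2 * p)) +
        (M * R) ^ (-1 / (q - 1)))) atTop
        (𝓝 (C * (M ^ (-(p + 1) / ((p + 1) * q - 2 * p)) + 0))) := by
      refine (Tendsto.const_add _ ?_).const_mul _
      rw [neg_div]
      exact (tendsto_rpow_neg_atTop (by positivity)).comp (tendsto_id.const_mul_atTop hM)
    have hle := ge_of_tendsto hlim <| by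
      filter_upwards [eventually_gt_atTop 0] with R hR
      exact hball M u x R hM hR fun y _ =>
        hu.contDiffAt_and_nonneg_and_equation isOpen_univ (Set.mem_univ y)
    rw [add_zero] at hle
    exact hle.trans (by gcongr)
  refine ⟨fun Ω u hΩ _ hu x hx => ?_, fun u hu => ⟨hglobal u hu.isSolution, fun x => ?_⟩⟩
  · by_cases hne : Ω = Set.univ
    · subst hne
      refine (hglobal u hu x).trans ?_
      rw [frontier_univ, Metric.infDist_empty, mul_zero,
        Real.zero_rpow (div_ne_zero (by norm_num) hq1'.ne'), add_zero]
    · have hd := infDist_frontier_pos hΩ hne hx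
      set d := Metric.infDist x (frontier Ω)
      have h := hball M u x (d / 2) hM (by positivity) fun y hy =>
        hu.contDiffAt_and_nonneg_and_equation hΩ (ball_infDist_frontier_subset hΩ hx
          (Metric.closedBall_subset_ball (half_lt_self hd) hy))
      have e : (M * (d / 2)) ^ (-1 / (q - 1)) = K * (M * d) ^ (-1 / (q - 1)) := by
        rw [← mul_div_assoc, Real.div_rpow (by positivity) (by norm_num), neg_div,
          Real.rpow_neg (x := 2) (by norm_num), div_inv_eq_mul, mul_comm]
      rw [e] at h
      refine h.trans ?_
      rw [mul_assoc C K, mul_add K]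
      gcongr
      exact le_mul_of_one_le_left (by positivity) hK1
  · set L := C * K * M ^ (-(p + 1) / ((p + 1) * q - 2 * p))
    have hdiff : ∀ y ∈ Set.univ, DifferentiableAt ℝ u y := fun y hy =>
      (hu.isSolution.contDiffAt_and_nonneg_and_equation isOpen_univ hy).1.differentiableAt
        (by simp)
    -- Linear growth is the mean value inequality with the global gradient bound.
    have hmv := convex_univ.norm_image_sub_le_of_norm_fderiv_le (C := L) hdiff
      (fun y _ => by
        rw [← toDual_gradient, LinearIsometryEquiv.norm_map]
        exact hglobal u hu.isSolution y) (Set.mem_univ 0) (Set.mem_univ x)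
    rw [sub_zero] at hmv
    linarith [(le_abs_self (u x - u 0)).trans hmv]
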